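/- Let $G=\mathbb Z^{(\mathbb N)}$ be the free abelian group of finitely supported integer sequences, totally ordered lexicographically (two distinct sequences are compared at the smallest index where they differ). The value group of a valuation domain $A$ with quotient field $Q$ and group of units $U$ is $Q^*/U$, ordered by $aU\le bU \iff ba^{-1}\in A$. (1) There exists a countable valuation domain whose value group is isomorphic to $G$ as an ordered group. (2) Let $A$ be any valuation domain whose value group is isomorphic to $G$ as an ordered group. Then the maximal ideal of $A$ is not principal, the global dimension of $A$ is $2$, and the telescope conjecture fails for the unbounded derived category $\mathbf D(\operatorname{Mod} A)$. Hence there is a countable valuation domain of global dimension $2$ for whose derived category the telescope conjecture fails. Here a localization functor on a triangulated category $\mathcal T$ is an exact functor $L\colon\mathcal T\to\mathcal T$ admitting a natural transformation $\eta\colon \mathrm{Id}\to L$ such that $L\eta_X$ is an isomorphism and $L\eta_X=\eta_{LX}$ for all $X$. A localizing subcategory is a full triangulated subcategory closed under direct summands and coproducts. A complex is perfect if it is isomorphic in $\mathbf D(\operatorname{Mod} A)$ to a bounded complex of finitely generated projective modules. A localizing subcategory $\mathcal C$ is generated by perfect complexes if no proper localizing subcategory of $\mathcal C$ contains all perfect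 complexes from $\mathcal C$. The telescope conjecture for $\mathbf D(\operatorname{Mod} A)$ asserts that every localizing subcategory of the form $\operatorname{Ker} L$, with $L$ a localization functor on $\mathbf D(\operatorname{Mod} A)$ preserving coproducts, is generated by perfect complexes. -/

import Mathlib

open CategoryTheory CategoryTheory.Limits

universe w v u

noncomputable section

/-- The global dimension of a commutative ring `A`: the supremum of the projective dimensions
of all `A`-modules. -/
def globalDimension (A : Type u) [CommRing A] : WithBot ℕ∞ :=
  ⨆ M : ModuleCat.{u} A, projectiveDimension M

/-- The valuation domain `A` has value group `ℤ^(ℕ)` with the lexicographic order.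

The invertible elements of `ValuationRing.ValueGroup A Q` are the classes `Q* / U`, where `Q` is
the quotient field of `A` and `U = Aˣ`. Mathlib orders them by `aU ≤ bU ↔ a / b ∈ A`, which is
opposite to the additive convention `aU ≤ bU ↔ b / a ∈ A`; hence the order dual on the right.
The order of `Lex (ℕ →₀ ℤ)` is decided by the smallest index at which two sequences differ. -/
def HasLexValueGroup (A : Type u) [CommRing A] [IsDomain A] [ValuationRing A] : Prop :=
  Nonempty ((ValuationRing.ValueGroup A (FractionRing A))ˣ ≃*o
    (Multiplicative (Lex (ℕ →₀ ℤ)))ᵒᵈ)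

section Triangulated

variable {T : Type u} [Category.{v} T] [HasZeroObject T] [HasShift T ℤ] [Preadditive T]
  [∀ n : ℤ, (shiftFunctor T n).Additive] [Pretriangulated T]

/-- A localization functor on a triangulated category `T`: an exact functor `L : T ⥤ T` that
admits a natural transformation `η : 𝟭 ⟶ L` such that `L η_X` is an isomorphism and
`L η_X = η_{L X}` for all `X`. -/
structure IsLocalizationFunctor (L : T ⥤ T) : Prop where
  exact : ∃ _ : L.CommShift ℤ, L.IsTriangulated
  unit : ∃ η : 𝟭 T ⟶ L, ∀ X : T,
    IsIso (L.map (η.app X)) ∧ L.map (η.app X) = η.app (L.obj X)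

/-- A localizing subcategory: a full triangulated subcategory closed under direct summands (in
particular, under isomorphisms) and under coproducts indexed by types in `Type w`. -/
structure IsLocalizingSubcategory (P : ObjectProperty T) : Prop where
  triangulated : P.IsTriangulated
  summands : P.IsStableUnderRetracts
  coproducts : ∀ J : Type w, P.IsClosedUnderColimitsOfShape (Discrete J)

/-- The kernel of a functor: the full subcategory of all objects that are sent to zero. -/
def functorKernel (L : T ⥤ T) : ObjectProperty T := fun X => IsZero (L.obj X)

end Triangulated

section DerivedCategory

variable (A : Type u) [CommRing A] [HasDerivedCategory.{w} (ModuleCat.{u} A)]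

/-- An object of the derived category of `A` is perfect if it is isomorphic to a bounded complex
of finitely generated projective modules. -/
def IsPerfectComplex : ObjectProperty (DerivedCategory (ModuleCat.{u} A)) := fun X =>
  ∃ K : CochainComplex (ModuleCat.{u} A) ℤ,
    (∃ a b : ℤ, ∀ i : ℤ, (i < a ∨ b < i) → IsZero (K.X i)) ∧
    (∀ i : ℤ, Module.Finite A (K.X i) ∧ Module.Projective A (K.X i)) ∧
    Nonempty (X ≅ DerivedCategory.Q.obj K)

variable {A} in
/-- A localizing subcategory `C` is generated by perfect complexes if `C` admits no proper
localizing subcategory that contains all perfect complexes from `C`. -/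
def IsGeneratedByPerfectComplexes
    (C : ObjectProperty (DerivedCategory (ModuleCat.{u} A))) : Prop :=
  ∀ S : ObjectProperty (DerivedCategory (ModuleCat.{u} A)),
    IsLocalizingSubcategory.{u} S → S ≤ C → (∀ X, C X → IsPerfectComplex A X → S X) → S = C

/-- The telescope conjecture for the derived category of `A`: every localizing subcategory that
is the kernel of a coproduct preserving localization functor is generated by perfect complexes. -/
def TelescopeConjecture : Prop :=
  ∀ C : ObjectProperty (DerivedCategory (ModuleCat.{u} A)),
    IsLocalizingSubcategory.{u} C →
    (∃ L : DerivedCategory (ModuleCat.{u} A) ⥤ DerivedCategory (ModuleCat.{u} A),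
      IsLocalizationFunctor L ∧
      (∀ J : Type u, PreservesColimitsOfShape (Discrete J) L) ∧
      C = functorKernel L) →
    IsGeneratedByPerfectComplexes C

end DerivedCategory

end

noncomputable section

/-! The order on `Lex (ℕ →₀ ℤ)` governs everything: it is countable and has no least positive
element. The second fact says that no element of the maximal ideal `m` divides all the others, so
`m` is not principal and every element of `m` is a product of two elements of `m`.

Countability writes each nonzero ideal as the union of an increasing sequence of principal ideals,
so the mapping telescope resolves it by free modules in length one
(`hasProjectiveDimensionLE_one_of_seq`). Cyclic modules then have projective dimension at most 2,
and Auslander's theorem bounds the global dimension. Equality holds because a projective ideal of a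
domain is finitely generated, hence principal here, so `m` is not projective.

For the telescope conjecture, `m` is flat and idempotent, so `m ⊗ -` is an exact idempotent
colocalization. On the derived category its cones form a coproduct preserving localization `L` whose
kernel consists of the `X` with `m ⊗ X ≅ X`. By Nakayama, applied from the top degree down, a
perfect complex in this kernel is zero, while `m` itself is a nonzero object of it.

For existence, take the subfield of Hahn series over `ℚ` generated by the monomials. -/

theorem HasLexValueGroup.exists_valuation {A : Type u} [CommRing A] [IsDomain A] [ValuationRing A]
    (h : HasLexValueGroup A) :
    ∃ f : A → Lex (ℕ →₀ ℤ), (∀ a b, a ≠ 0 → b ≠ 0 → (a ∣ b ↔ f a ≤ f b)) ∧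
      f 1 = 0 ∧ ∀ g, 0 ≤ g → ∃ a, a ≠ 0 ∧ f a = g := by
  classical
  obtain ⟨e⟩ := h
  let K := FractionRing A
  let v := ValuationRing.valuation A K
  let ν : Kˣ →* (Multiplicative (Lex (ℕ →₀ ℤ)))ᵒᵈ :=
    (e.toMulEquiv.toMonoidHom).comp (Units.map v.toMonoidWithZeroHom.toMonoidHom)
  have hν : ∀ x y : Kˣ, ν x ≤ ν y ↔ ∃ c : A, algebraMap A K c * y = x := by
    intro x y
    have : ν x ≤ ν y ↔ v x ≤ v y := by
      change e _ ≤ e _ ↔ _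
      rw [map_le_map_iff e]
      rfl
    rw [this]
    change (∃ c : A, c • (y : K) = x) ↔ _
    simp only [Algebra.smul_def]
  have hsurj : ∀ g, ∃ x : Kˣ, ν x = g := by
    intro g
    obtain ⟨y, hy⟩ := e.surjective g
    obtain ⟨x, hx⟩ := Quotient.exists_rep (y : ValuationRing.ValueGroup A K)
    have hx' : v x = y := hx
    have hx0 : x ≠ 0 := by
      rintro rfl
      rw [map_zero] at hx'
      exact y.ne_zero hx'.symm
    refine ⟨Units.mk0 x hx0, ?_⟩
    rw [← hy]
    change e _ = e _
    congr 1
    ext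
    exact hx'
  have hinj : ∀ a : A, a ≠ 0 → algebraMap A K a ≠ 0 := fun a ha => by
    simpa using ha
  -- The value at zero is a dummy; only values at nonzero elements are used.
  let f : A → Lex (ℕ →₀ ℤ) := fun a =>
    if ha : a ≠ 0 then (OrderDual.ofDual (ν (Units.mk0 _ (hinj a ha)))).toAdd else 0
  have hf : ∀ a (ha : a ≠ 0), f a = (OrderDual.ofDual (ν (Units.mk0 _ (hinj a ha)))).toAdd :=
    fun a ha => dif_pos ha
  have h1 : f 1 = 0 := by
    have : Units.mk0 (algebraMap A K 1) (hinj 1 one_ne_zero) = 1 := by ext; simp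
    rw [hf 1 one_ne_zero, this, map_one]
    rfl
  refine ⟨f, fun a b ha hb => ?_, h1, fun g hg => ?_⟩
  · rw [hf a ha, hf b hb]
    change _ ↔ ν _ ≤ ν _
    rw [hν]
    constructor
    · rintro ⟨c, rfl⟩
      exact ⟨c, by simp [mul_comm]⟩
    · rintro ⟨c, hc⟩
      refine ⟨c, IsFractionRing.injective A K ?_⟩
      simpa [mul_comm] using hc.symm
  · obtain ⟨x, hx⟩ := hsurj (OrderDual.toDual (Multiplicative.ofAdd g))
    have : ν x ≤ ν 1 := by
      rw [hx, map_one]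
      exact hg
    obtain ⟨c, hc⟩ := (hν _ _).1 this
    have hc0 : c ≠ 0 := by
      rintro rfl
      simp at hc
      exact x.ne_zero hc.symm
    refine ⟨c, hc0, ?_⟩
    have : Units.mk0 (algebraMap A K c) (hinj c hc0) = x := by ext; simpa using hc
    rw [hf c hc0, this, hx]
    rfl

/-- Moving the leading index one step to the right makes a positive sequence infinitely smaller, so
there is no least positive element. -/
theorem exists_pos_lt_lex_finsupp {g : Lex (ℕ →₀ ℤ)} (hg : 0 < g) :
    ∃ h : Lex (ℕ →₀ ℤ), 0 < h ∧ h < g := by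
  obtain ⟨n, hn, hpos⟩ := Finsupp.lex_def.1 hg
  refine ⟨toLex (Finsupp.single (n + 1) 1), Finsupp.lex_def.2 ⟨n + 1, ?_, ?_⟩,
    Finsupp.lex_def.2 ⟨n, ?_, ?_⟩⟩
  · intro d hd
    simp [hd.ne']
  · simp
  · intro d hd
    have := hn d hd
    simp only [ofLex_toLex, ← this]
    simp [show n + 1 ≠ d by lia]
  · simpa [Finsupp.single_apply] using hpos

/-! ### Ideals under the lexicographic value group -/

section LexValueGroup

variable {A : Type u} [CommRing A] [IsDomain A] [ValuationRing A]

theorem HasLexValueGroup.not_isPrincipal_maximalIdeal (h : HasLexValueGroup A) :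
    ¬ (IsLocalRing.maximalIdeal A).IsPrincipal := by
  rintro ⟨a, ha⟩
  obtain ⟨f, hf, h1, hs⟩ := h.exists_valuation
  have key : ∀ b, b ≠ 0 → (0 < f b ↔ b ∈ IsLocalRing.maximalIdeal A) := fun b hb => by
    rw [IsLocalRing.mem_maximalIdeal, mem_nonunits_iff, isUnit_iff_dvd_one,
      hf b 1 hb one_ne_zero, h1, not_le]
  have mem_iff : ∀ b, b ∈ IsLocalRing.maximalIdeal A ↔ a ∣ b := fun b => by
    rw [ha]; exact Ideal.mem_span_singleton
  have hsmall : ∀ g, 0 < g → ∃ b, b ≠ 0 ∧ a ∣ b ∧ f b = g := fun g hg => by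
    obtain ⟨b, hb, rfl⟩ := hs g hg.le
    exact ⟨b, hb, (mem_iff b).1 ((key b hb).1 hg), rfl⟩
  have hpos : (0 : Lex (ℕ →₀ ℤ)) < toLex (Finsupp.single 0 1) :=
    Finsupp.lex_def.2 ⟨0, by simp, by simp⟩
  have ha0 : a ≠ 0 := by
    rintro rfl
    obtain ⟨b, hb, hab, -⟩ := hsmall _ hpos
    exact hb (zero_dvd_iff.1 hab)
  obtain ⟨g, hg0, hg⟩ := exists_pos_lt_lex_finsupp ((key a ha0).2 ((mem_iff a).2 dvd_rfl))
  obtain ⟨b, hb, hab, rfl⟩ := hsmall g hg0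
  exact hg.not_ge ((hf a b ha0 hb).1 hab)

/-- If the value group is countable, every nonzero ideal is the union of a chain of principal
ideals indexed by `ℕ`. -/
theorem HasLexValueGroup.exists_seq (h : HasLexValueGroup A) (I : Ideal A) (hI : I ≠ ⊥) :
    ∃ a : ℕ → A, (∀ n, a n ≠ 0) ∧ (∀ n, a (n + 1) ∣ a n) ∧ (∀ n, a n ∈ I) ∧
      ∀ x ∈ I, ∃ n, a n ∣ x := by
  classical
  obtain ⟨f, hf, -, -⟩ := h.exists_valuation
  -- Only the values of elements of `I` matter for divisibility, and they form a countable set even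
  -- when `A` is uncountable.
  let s : Set (Lex (ℕ →₀ ℤ)) := f '' {x | x ∈ I ∧ x ≠ 0}
  have : Countable (Lex (ℕ →₀ ℤ)) := inferInstanceAs (Countable (ℕ →₀ ℤ))
  have hs : s.Nonempty := by
    obtain ⟨x, hx, hx0⟩ := Submodule.exists_mem_ne_zero_of_ne_bot hI
    exact ⟨f x, x, ⟨hx, hx0⟩, rfl⟩
  obtain ⟨g, hg⟩ := s.to_countable.exists_eq_range hs
  have hb : ∀ n, ∃ x, (x ∈ I ∧ x ≠ 0) ∧ f x = g n := fun n => by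
    have : g n ∈ s := hg ▸ Set.mem_range_self n
    simpa [s] using this
  choose b hbI hbg using hb
  -- `a n` is a running minimum for divisibility: one of `b 0, …, b n` that divides all of them.
  let a : ℕ → A := fun n => Nat.rec (b 0) (fun k y => if b (k + 1) ∣ y then b (k + 1) else y) n
  have ha1 : ∀ n : ℕ, (b (n + 1) ∣ a n ∧ a (n + 1) = b (n + 1)) ∨
      (¬ b (n + 1) ∣ a n ∧ a (n + 1) = a n) := fun n => by
    by_cases h : b (n + 1) ∣ a n
    · exact Or.inl ⟨h, if_pos h⟩
    · exact Or.inr ⟨h, if_neg h⟩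
  have hab : ∀ n, a n ∣ b n := by
    rintro (_ | n)
    · exact dvd_rfl
    · rcases ha1 n with ⟨h, e⟩ | ⟨h, e⟩ <;> rw [e]
      exact (ValuationRing.dvd_total _ _).resolve_left h
  have hmem : ∀ n, a n ∈ I ∧ a n ≠ 0 := by
    intro n
    induction n with
    | zero => exact hbI 0
    | succ n ih =>
      rcases ha1 n with ⟨h, e⟩ | ⟨h, e⟩ <;> rw [e]
      · exact hbI _
      · exact ih
  refine ⟨a, fun n => (hmem n).2, fun n => ?_, fun n => (hmem n).1, fun x hx => ?_⟩
  · rcases ha1 n with ⟨h, e⟩ | ⟨h, e⟩ <;> rw [e]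
    exact h
  · by_cases hx0 : x = 0
    · exact ⟨0, hx0 ▸ dvd_zero _⟩
    · have : f x ∈ Set.range g := hg ▸ ⟨x, ⟨hx, hx0⟩, rfl⟩
      obtain ⟨n, hn⟩ := this
      refine ⟨n, (hab n).trans ((hf _ _ (hbI n).2 hx0).2 ?_)⟩
      rw [hbg, hn]

end LexValueGroup

/-! ### Idempotence and non-projectivity of the maximal ideal -/

section ValuationRing

variable {A : Type u} [CommRing A] [IsDomain A] [ValuationRing A]

/-- As `a` does not generate the maximal ideal, some `b` in it is not a multiple of `a`. Then `b`
divides `a` properly, so the cofactor is a nonunit too. -/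
theorem ValuationRing.exists_mul_eq_of_mem_maximalIdeal
    (h : ¬ (IsLocalRing.maximalIdeal A).IsPrincipal) {a : A}
    (ha : a ∈ IsLocalRing.maximalIdeal A) :
    ∃ b ∈ IsLocalRing.maximalIdeal A, ∃ c ∈ IsLocalRing.maximalIdeal A, b * c = a := by
  have : ∃ b ∈ IsLocalRing.maximalIdeal A, ¬ a ∣ b := by
    by_contra! hb
    refine h ⟨a, le_antisymm (fun b hb' => Ideal.mem_span_singleton.2 (hb b hb')) ?_⟩
    exact (Ideal.span_singleton_le_iff_mem _).2 ha
  obtain ⟨b, hb, hab⟩ := this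
  obtain ⟨c, rfl⟩ := (ValuationRing.dvd_total a b).resolve_left hab
  refine ⟨b, hb, c, ?_, rfl⟩
  by_contra hc
  have hc : IsUnit c := by simpa using hc
  exact hab (hc.mul_right_dvd.2 dvd_rfl)

/-- For a section `s` of the canonical map from the free module on `I`, linearity gives `a • s x = x
• s a`. In a domain this confines the support of every `s x` to the finite support of `s a`, whose
members therefore generate `I`. -/
theorem Ideal.fg_of_projective {R : Type u} [CommRing R] [IsDomain R] (I : Ideal R)
    [Module.Projective R I] : I.FG := by
  classical
  by_cases hI : I = ⊥
  · exact hI ▸ Submodule.fg_bot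
  obtain ⟨a, ha, ha0⟩ := Submodule.exists_mem_ne_zero_of_ne_bot hI
  obtain ⟨s, hs⟩ := (Module.projective_def' (R := R) (P := I)).1 inferInstance
  let a' : I := ⟨a, ha⟩
  refine ⟨(s a').support.image (fun x : I => (x : R)), le_antisymm ?_ ?_⟩
  · rw [Submodule.span_le]
    intro y hy
    obtain ⟨x, -, rfl⟩ := Finset.mem_image.1 (Finset.mem_coe.1 hy)
    exact x.2
  · intro x hx
    let x' : I := ⟨x, hx⟩
    have hsub : (s x').support ⊆ (s a').support := by
      intro i hi
      have hcomm : a • x' = x • a' := by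
        ext
        simp [a', x', mul_comm]
      have := congrArg (fun t => s t i) hcomm
      simp only [map_smul, Finsupp.smul_apply, smul_eq_mul] at this
      rw [Finsupp.mem_support_iff] at hi ⊢
      intro h0
      rw [h0, mul_zero] at this
      exact (mul_ne_zero ha0 hi) this
    have hx' := LinearMap.congr_fun hs x'
    have : (x : R) = ∑ i ∈ (s x').support, s x' i * (i : R) := by
      have h2 := congrArg (fun t : I => (t : R)) hx'
      simp only [LinearMap.comp_apply, Finsupp.linearCombination_apply, Finsupp.sum,
        LinearMap.id_apply] at h2
      rw [← show ((x' : I) : R) = x from rfl, ← h2]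
      simp
    rw [this]
    refine Submodule.sum_mem _ fun i hi => Submodule.smul_mem _ _ (Submodule.subset_span ?_)
    exact Finset.mem_coe.2 (Finset.mem_image_of_mem _ (hsub hi))

theorem ValuationRing.not_projective_maximalIdeal
    (h : ¬ (IsLocalRing.maximalIdeal A).IsPrincipal) :
    ¬ Module.Projective A (IsLocalRing.maximalIdeal A) := fun _ =>
  h (IsBezout.isPrincipal_of_FG _ (Ideal.fg_of_projective _))

end ValuationRing


/-! ### Global dimension -/

section GlobalDimension

open CategoryTheory.Abelian

variable {A : Type u} [CommRing A]

/-- The short exact sequence `0 → I → A → A ⧸ I → 0`. -/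
abbrev Ideal.quotientShortComplex (I : Ideal A) : ShortComplex (ModuleCat.{u} A) :=
  ModuleCat.shortComplexOfCompEqZero (ModuleCat.ofHom I.subtype).hom
    (ModuleCat.ofHom I.mkQ).hom (by ext x; simpa using Ideal.Quotient.eq_zero_iff_mem.2 x.2)

theorem Ideal.quotientShortComplex_shortExact (I : Ideal A) :
    I.quotientShortComplex.ShortExact :=
  ModuleCat.shortComplex_shortExact _
    (by
      rw [LinearMap.exact_iff]
      simp [Ideal.quotientShortComplex])
    (Submodule.subtype_injective I) (Submodule.mkQ_surjective I)

/-- Baer's criterion: the obstruction to extending `I → N` along `I → A` lies in `Ext¹(A ⧸ I, N)`.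
-/
theorem ModuleCat.injective_of_subsingleton_ext_one (N : ModuleCat.{u} A)
    (h : ∀ I : Ideal A, Subsingleton (Ext (ModuleCat.of A (A ⧸ I)) N 1)) : Injective N := by
  rw [← Module.injective_iff_injective_object]
  apply Module.Baer.injective
  intro I g
  let S := I.quotientShortComplex
  have hS : S.ShortExact := I.quotientShortComplex_shortExact
  obtain ⟨y, hy⟩ := Ext.contravariant_sequence_exact₁ hS N
    (Ext.mk₀ (ModuleCat.ofHom g : S.X₁ ⟶ N)) (n₁ := 1) rfl ((h I).elim _ _)
  obtain ⟨φ, rfl⟩ := Ext.homEquiv₀.symm.surjective y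
  rw [Ext.homEquiv₀_symm_apply, Ext.mk₀_comp_mk₀] at hy
  have := Ext.homEquiv₀.symm.injective hy
  refine ⟨φ.hom, fun x hx => ?_⟩
  exact LinearMap.congr_fun (congrArg ModuleCat.Hom.hom this) ⟨x, hx⟩

/-- Dimension shifting along an embedding of `N` into an injective module reduces to Baer's
criterion. -/
theorem ModuleCat.hasInjectiveDimensionLE_of_subsingleton_ext (n : ℕ) (N : ModuleCat.{u} A)
    (h : ∀ I : Ideal A, Subsingleton (Ext (ModuleCat.of A (A ⧸ I)) N (n + 1))) :
    HasInjectiveDimensionLE N n := by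
  induction n generalizing N with
  | zero =>
    have := ModuleCat.injective_of_subsingleton_ext_one N h
    exact injective_iff_hasInjectiveDimensionLT_one.1 this
  | succ n ih =>
    obtain ⟨J, _, f, _⟩ := (inferInstance : EnoughInjectives (ModuleCat.{u} A)).1 N
    let S := ShortComplex.mk f (cokernel.π f) (cokernel.condition f)
    have hS : S.ShortExact := { exact := ShortComplex.exact_cokernel f }
    refine (hS.hasInjectiveDimensionLT_X₃_iff n inferInstance).1 (ih S.X₃ fun I => ⟨?_⟩)
    suffices ∀ x : Ext (ModuleCat.of A (A ⧸ I)) S.X₃ (n + 1), x = 0 from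
      fun x y => (this x).trans (this y).symm
    intro x
    obtain ⟨y, rfl⟩ := Ext.covariant_sequence_exact₃ _ hS x rfl ((h I).elim _ _)
    rw [show y = 0 from Ext.eq_zero_of_hasInjectiveDimensionLT y 1 (by lia), Ext.zero_comp]

/-- Auslander's theorem: the global dimension is detected on cyclic modules. -/
theorem globalDimension_le_of_forall_quotient (n : ℕ)
    (h : ∀ I : Ideal A, HasProjectiveDimensionLE (ModuleCat.of A (A ⧸ I)) n) :
    globalDimension A ≤ n := by
  refine iSup_le fun M => ?_
  rw [projectiveDimension_le_iff]
  have : ∀ N : ModuleCat.{u} A, HasInjectiveDimensionLE N n := fun N =>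
    ModuleCat.hasInjectiveDimensionLE_of_subsingleton_ext n N fun I =>
      HasProjectiveDimensionLT.subsingleton _ (n + 1) (n + 1) le_rfl N
  refine HasProjectiveDimensionLT.mk fun i hi N e => ?_
  exact Ext.eq_zero_of_hasInjectiveDimensionLT e (n + 1) hi

variable [IsDomain A]

/-- The ideal is the sequential colimit of the free modules `(a n)`. With `a n = a (n + 1) * r n`,
the telescope map `φ : e_n ↦ e_n - r_n e_{n+1}` between free modules has cokernel `I` via `ψ : e_n ↦
a n`. -/
theorem hasProjectiveDimensionLE_one_of_seq (I : Ideal A) (a : ℕ → A) (ha0 : ∀ n, a n ≠ 0)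
    (ha : ∀ n, a (n + 1) ∣ a n) (haI : ∀ n, a n ∈ I) (hI : ∀ x ∈ I, ∃ n, a n ∣ x) :
    HasProjectiveDimensionLE (ModuleCat.of A I) 1 := by
  classical
  choose r hr using ha
  let φ : (ℕ →₀ A) →ₗ[A] (ℕ →₀ A) := Finsupp.linearCombination A
    (fun n => Finsupp.single n (1 : A) - Finsupp.single (n + 1) (r n))
  let ψ : (ℕ →₀ A) →ₗ[A] I := Finsupp.linearCombination A (fun n => (⟨a n, haI n⟩ : I))
  have hφ : ∀ n c, φ (Finsupp.single n c) =
      Finsupp.single n c - Finsupp.single (n + 1) (c * r n) := fun n c => by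
    simp [φ, Finsupp.linearCombination_single, smul_sub]
  have hψ : ∀ n c, ((ψ (Finsupp.single n c) : I) : A) = c * a n := fun n c => by
    simp [ψ, Finsupp.linearCombination_single]
  have hcomp : ψ ∘ₗ φ = 0 := by
    ext n
    simp only [LinearMap.comp_apply, Finsupp.lsingle_apply, hφ, map_sub, LinearMap.zero_apply,
      AddSubgroupClass.coe_sub, hψ]
    simp [hr n, mul_comm]
  have hφ0 : ∀ x : ℕ →₀ A, φ x 0 = x 0 := fun x => by
    induction x using Finsupp.induction_linear with
    | zero => simp
    | add x y hx hy => simp [hx, hy]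
    | single n c => simp [hφ, Finsupp.single_apply]
  have hφs : ∀ (x : ℕ →₀ A) (k : ℕ), φ x (k + 1) = x (k + 1) - x k * r k := fun x k => by
    induction x using Finsupp.induction_linear with
    | zero => simp
    | add x y hx hy => simp only [map_add, Finsupp.add_apply, hx, hy]; ring
    | single n c =>
      by_cases h : n = k
      · subst h; simp [hφ]
      · simp [hφ, Finsupp.single_apply, h]
  have hφinj : Function.Injective φ := by
    rw [← LinearMap.ker_eq_bot, LinearMap.ker_eq_bot']
    intro x hx
    ext k
    induction k with
    | zero => rw [← hφ0, hx]
    | succ k ih =>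
      have := hφs x k
      rw [hx, ih] at this
      simpa using this.symm
  -- Modulo the range of `φ` a basis vector can be pushed arbitrarily far to the right. Hence any
  -- vector is congruent to some `d e_m`, and `ψ` kills this only if `d = 0`.
  have hpush : ∀ (n k : ℕ) (c : A), ∃ d, Finsupp.single n c - Finsupp.single (n + k) d ∈
      LinearMap.range φ := by
    intro n k
    induction k with
    | zero => exact fun c => ⟨c, by simp⟩
    | succ k ih =>
      intro c
      obtain ⟨d, hd⟩ := ih c
      refine ⟨d * r (n + k), ?_⟩
      have := add_mem hd ⟨_, hφ (n + k) d⟩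
      rwa [sub_add_sub_cancel] at this
  have hreduce : ∀ x : ℕ →₀ A, ∃ n, ∀ m, n ≤ m → ∃ d, x - Finsupp.single m d ∈ LinearMap.range φ := by
    intro x
    induction x using Finsupp.induction_linear with
    | zero => exact ⟨0, fun m _ => ⟨0, by simp⟩⟩
    | single n c =>
      refine ⟨n, fun m hm => ?_⟩
      obtain ⟨k, rfl⟩ := Nat.exists_eq_add_of_le hm
      exact hpush n k c
    | add x y hx hy =>
      obtain ⟨n, hn⟩ := hx
      obtain ⟨n', hn'⟩ := hy
      refine ⟨max n n', fun m hm => ?_⟩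
      obtain ⟨d, hd⟩ := hn m (le_trans (le_max_left _ _) hm)
      obtain ⟨d', hd'⟩ := hn' m (le_trans (le_max_right _ _) hm)
      refine ⟨d + d', ?_⟩
      have := add_mem hd hd'
      rwa [sub_add_sub_comm, ← Finsupp.single_add] at this
  have hexact : Function.Exact φ ψ := by
    intro x
    constructor
    · intro hx
      obtain ⟨n, hn⟩ := hreduce x
      obtain ⟨d, y, hy⟩ := hn n le_rfl
      have h1 : ψ (φ y) = 0 := LinearMap.congr_fun hcomp y
      rw [hy, map_sub, hx, zero_sub, neg_eq_zero] at h1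
      have h2 := hψ n d
      rw [h1, ZeroMemClass.coe_zero] at h2
      have hd : d = 0 := by simpa [ha0 n] using h2.symm
      exact ⟨y, by simp [hy, hd]⟩
    · rintro ⟨y, rfl⟩
      exact LinearMap.congr_fun hcomp y
  have hψsurj : Function.Surjective ψ := by
    rintro ⟨x, hx⟩
    obtain ⟨n, c, rfl⟩ := hI x hx
    exact ⟨Finsupp.single n c, by ext; rw [hψ, mul_comm]⟩
  let S : ShortComplex (ModuleCat.{u} A) :=
    ModuleCat.shortComplexOfCompEqZero (ModuleCat.ofHom φ).hom (ModuleCat.ofHom ψ).hom hcomp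
  have hS : S.ShortExact := ModuleCat.shortComplex_shortExact S hexact hφinj hψsurj
  have hF : Projective (ModuleCat.of A (ℕ →₀ A)) :=
    (IsProjective.iff_projective (R := A) (ℕ →₀ A)).1 inferInstance
  have h1 : Projective S.X₁ := hF
  have h2 : Projective S.X₂ := hF
  exact (hS.hasProjectiveDimensionLT_X₃_iff 0 h2).2 inferInstance

theorem ModuleCat.projective_of_self (A : Type u) [CommRing A] : Projective (ModuleCat.of A A) :=
  (IsProjective.iff_projective (R := A) A).1 inferInstance

theorem HasLexValueGroup.globalDimension_eq_two [ValuationRing A] (h : HasLexValueGroup A) :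
    globalDimension A = 2 := by
  apply le_antisymm
  · refine globalDimension_le_of_forall_quotient 2 fun I => ?_
    have hS := I.quotientShortComplex_shortExact
    have hX₂ : Projective I.quotientShortComplex.X₂ := ModuleCat.projective_of_self A
    refine (hS.hasProjectiveDimensionLT_X₃_iff 1 hX₂).2 ?_
    by_cases hI : I = ⊥
    · have : IsZero I.quotientShortComplex.X₁ := by
        rw [ModuleCat.isZero_iff_subsingleton]
        subst hI
        infer_instance
      have := this.hasProjectiveDimensionLT_zero
      exact hasProjectiveDimensionLT_of_ge _ 0 _ (by lia)
    · obtain ⟨a, ha0, ha, haI, hI⟩ := h.exists_seq I hI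
      exact hasProjectiveDimensionLE_one_of_seq I a ha0 ha haI hI
  · let I := IsLocalRing.maximalIdeal A
    refine le_trans ?_ (le_iSup _ (ModuleCat.of A (A ⧸ I)))
    -- Projective dimension at most one for the residue field would make the maximal ideal
    -- projective.
    refine (projectiveDimension_ge_iff _ 2).2 fun h2 => ?_
    have hS := I.quotientShortComplex_shortExact
    have hX₂ : Projective I.quotientShortComplex.X₂ := ModuleCat.projective_of_self A
    have h1 := (hS.hasProjectiveDimensionLT_X₃_iff 0 hX₂).1 h2
    have h0 : Projective (ModuleCat.of A I) := projective_iff_hasProjectiveDimensionLT_one.2 h1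
    exact ValuationRing.not_projective_maximalIdeal h.not_isPrincipal_maximalIdeal
      ((IsProjective.iff_projective (R := A) I).2 h0)

end GlobalDimension


/-! ### A countable example inside a Hahn series field -/

section Existence

/-- The preorders pulled back to `G` agree, so both maps have the same fibres, and arbitrary lifts
through one surjection give a well-behaved map to the other target. -/
theorem nonempty_orderMonoidIso_of_surjective {G H₁ H₂ : Type*} [Group G] [Group H₁]
    [PartialOrder H₁] [Group H₂] [PartialOrder H₂] (f₁ : G →* H₁) (f₂ : G →* H₂)
    (h₁ : Function.Surjective f₁) (h₂ : Function.Surjective f₂)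
    (h : ∀ x y, f₁ x ≤ f₁ y ↔ f₂ x ≤ f₂ y) : Nonempty (H₁ ≃*o H₂) := by
  have heq : ∀ x y, f₁ x = f₁ y ↔ f₂ x = f₂ y := fun x y => by
    rw [le_antisymm_iff, le_antisymm_iff, h, h]
  have hs₁ := Function.surjInv_eq h₁
  have hs₂ := Function.surjInv_eq h₂
  refine ⟨⟨⟨⟨fun a => f₂ (Function.surjInv h₁ a), fun b => f₁ (Function.surjInv h₂ b),
    fun a => ?_, fun b => ?_⟩, fun a b => ?_⟩, fun {a b} => ?_⟩⟩
  · dsimp only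
    conv_rhs => rw [← hs₁ a]
    rw [heq, hs₂]
  · dsimp only
    conv_rhs => rw [← hs₂ b]
    rw [← heq, hs₁]
  · dsimp only
    rw [← map_mul, ← heq, map_mul, hs₁, hs₁, hs₁]
  · change f₂ _ ≤ f₂ _ ↔ _
    rw [← h, hs₁, hs₁]

theorem HasLexValueGroup.of_valuationSubring {K : Type u} [Field K] (A : ValuationSubring K)
    (o : Kˣ →* (Multiplicative (Lex (ℕ →₀ ℤ)))ᵒᵈ) (ho : Function.Surjective o)
    (hA : ∀ x : Kˣ, (x : K) ∈ A ↔ o x ≤ 1) : HasLexValueGroup A := by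
  let F := FractionRing A
  let e : F ≃ₐ[A] K := FractionRing.algEquiv A K
  let v := ValuationRing.valuation A F
  refine nonempty_orderMonoidIso_of_surjective (G := Fˣ)
    (Units.map v.toMonoidWithZeroHom.toMonoidHom)
    (o.comp (Units.mapEquiv e.toMulEquiv).toMonoidHom) ?_
    (ho.comp (Units.mapEquiv e.toMulEquiv).surjective) ?_
  · intro y
    obtain ⟨x, hx⟩ := Quotient.exists_rep (y : ValuationRing.ValueGroup A F)
    have hx' : v x = y := hx
    have hx0 : x ≠ 0 := by
      rintro rfl
      rw [map_zero] at hx'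
      exact y.ne_zero hx'.symm
    exact ⟨Units.mk0 x hx0, Units.ext hx'⟩
  · intro x y
    change (∃ c : A, c • (y : F) = x) ↔ o (Units.mapEquiv e.toMulEquiv x) ≤
      o (Units.mapEquiv e.toMulEquiv y)
    rw [← div_le_one', ← map_div, ← map_div, ← hA]
    have hval : ((Units.mapEquiv e.toMulEquiv (x / y) : Kˣ) : K) = e x / e y := by
      rw [map_div, Units.val_div_eq_div_val]
      rfl
    rw [hval]
    have hy : e y ≠ 0 := by simp
    constructor
    · rintro ⟨c, hc⟩
      have : e x / e y = c := by
        rw [← hc, map_smul, Algebra.smul_def, mul_div_assoc, div_self hy, mul_one]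
        rfl
      rw [this]
      exact c.2
    · intro h
      refine ⟨⟨_, h⟩, e.injective ?_⟩
      rw [map_smul, Algebra.smul_def]
      exact div_mul_cancel₀ _ hy

variable (Γ R : Type*) [AddCommGroup Γ] [LinearOrder Γ] [IsOrderedAddMonoid Γ] [Field R]

/-- The valuation ring of the field of Hahn series. -/
def HahnSeries.valuationSubring : ValuationSubring (HahnSeries Γ R) where
  carrier := {x | x = 0 ∨ 0 ≤ x.order}
  mul_mem' {a b} ha hb := by
    by_cases ha0 : a = 0
    · exact Or.inl (by simp [ha0])
    by_cases hb0 : b = 0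
    · exact Or.inl (by simp [hb0])
    right
    rw [HahnSeries.order_mul ha0 hb0]
    exact add_nonneg (ha.resolve_left ha0) (hb.resolve_left hb0)
  one_mem' := Or.inr (by simp)
  add_mem' {a b} ha hb := by
    by_cases hab : a + b = 0
    · exact Or.inl hab
    by_cases ha0 : a = 0
    · simpa [ha0] using hb
    by_cases hb0 : b = 0
    · simpa [hb0] using ha
    right
    exact le_trans (le_min (ha.resolve_left ha0) (hb.resolve_left hb0))
      (HahnSeries.min_order_le_order_add hab)
  zero_mem' := Or.inl rfl
  neg_mem' {a} ha := by
    rcases ha with rfl | ha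
    · exact Or.inl neg_zero
    · exact Or.inr (by rwa [HahnSeries.order_neg])
  mem_or_inv_mem' a := by
    by_cases ha0 : a = 0
    · exact Or.inl (Or.inl ha0)
    have h : a.order + (a⁻¹).order = 0 := by
      rw [← HahnSeries.order_mul ha0 (inv_ne_zero ha0), mul_inv_cancel₀ ha0, HahnSeries.order_one]
    rcases le_total 0 a.order with h0 | h0
    · exact Or.inl (Or.inr h0)
    · exact Or.inr (Or.inr (by rw [eq_neg_of_add_eq_zero_right h]; exact neg_nonneg.2 h0))

/-- The order of Hahn series as a homomorphism. -/
def HahnSeries.orderHom : (HahnSeries Γ R)ˣ →* (Multiplicative Γ)ᵒᵈ where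
  toFun x := OrderDual.toDual (Multiplicative.ofAdd (x : HahnSeries Γ R).order)
  map_one' := by
    rw [Units.val_one, HahnSeries.order_one]
    rfl
  map_mul' x y := by
    rw [Units.val_mul, HahnSeries.order_mul x.ne_zero y.ne_zero]
    rfl

theorem exists_countable_hasLexValueGroup :
    ∃ (A : Type u) (_ : CommRing A) (_ : IsDomain A) (_ : ValuationRing A),
      Countable A ∧ HasLexValueGroup A := by
  let Γ := Lex (ℕ →₀ ℤ)
  let t : Γ → HahnSeries Γ ℚ := fun g => HahnSeries.single g 1
  -- A subfield generated by countably many elements is countable, and the monomials already realize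
  -- every value in `Γ`.
  let K₀ : Subfield (HahnSeries Γ ℚ) := Subfield.closure (Set.range t)
  have hΓ : Countable Γ := inferInstanceAs (Countable (ℕ →₀ ℤ))
  have hK₀ : Countable K₀ := by
    rw [← Cardinal.mk_le_aleph0_iff]
    refine (Subfield.cardinalMk_closure_le_max _).trans (max_le ?_ le_rfl)
    exact Cardinal.mk_le_aleph0_iff.2 (Set.countable_range t)
  let K := ULift.{u} K₀
  have hK : Countable K := inferInstanceAs (Countable (ULift.{u} K₀))
  let i : K →+* HahnSeries Γ ℚ := K₀.subtype.comp ULift.ringEquiv.toRingHom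
  let A : ValuationSubring K := (HahnSeries.valuationSubring Γ ℚ).comap i
  refine ⟨A, inferInstance, inferInstance, inferInstance,
    Subtype.val_injective.countable, ?_⟩
  refine HasLexValueGroup.of_valuationSubring A
    ((HahnSeries.orderHom Γ ℚ).comp (Units.map i.toMonoidHom)) ?_ ?_
  · intro g
    let g' : Γ := (OrderDual.ofDual g).toAdd
    let x : K := ⟨⟨t g', Subfield.subset_closure ⟨g', rfl⟩⟩⟩
    have hix : i x = t g' := rfl
    have hx : x ≠ 0 := by
      intro h0
      rw [h0, map_zero] at hix
      exact HahnSeries.single_ne_zero one_ne_zero hix.symm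
    refine ⟨Units.mk0 x hx, ?_⟩
    change OrderDual.toDual (Multiplicative.ofAdd (t g').order) = g
    rw [HahnSeries.order_single one_ne_zero]
    rfl
  · intro x
    change i x = 0 ∨ 0 ≤ (i x).order ↔ 0 ≤ (i x).order
    exact or_iff_right (by simp)

end Existence


/-! ### Coproducts in the derived category -/

section DerivedCoproducts

variable {C : Type u} [Category.{v} C] [Abelian C] {J : Type v}

namespace HomologicalComplex

variable {ι : Type*} {c : ComplexShape ι}

/-- A family of complexes, as a complex in the category of families. -/
@[simps]
def familyComplex (K : J → HomologicalComplex C c) : HomologicalComplex (Discrete J ⥤ C) c where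
  X n := Discrete.functor fun j => (K j).X n
  d n m := Discrete.natTrans fun j => (K j.as).d n m
  shape n m h := by ext j; exact (K j.as).shape n m h
  d_comp_d' n m k _ _ := by ext j; exact (K j.as).d_comp_d n m k

/-- A family of morphisms of complexes, as a morphism of complexes of families. -/
@[simps]
def familyMap {K L : J → HomologicalComplex C c} (f : ∀ j, K j ⟶ L j) :
    familyComplex K ⟶ familyComplex L where
  f n := Discrete.natTrans fun j => (f j.as).f n
  comm' n m _ := by ext j; exact (f j.as).comm n m

theorem isIso_of_comp_iso_eq {D : Type*} [Category D] {X Y X' Y' : D} {f : X ⟶ Y}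
    (hf : IsIso f) (e : Y ≅ Y') (e' : X ≅ X') {g : X' ⟶ Y'} (h : f ≫ e.hom = e'.hom ≫ g) :
    IsIso g := by
  rw [← Iso.inv_comp_eq] at h
  rw [← h]
  infer_instance

/-- Evaluation functors are exact and jointly detect isomorphisms, so homology of a complex of
families is computed memberwise. -/
theorem quasiIso_of_evaluation {K L : HomologicalComplex (Discrete J ⥤ C) c} (f : K ⟶ L)
    (h : ∀ j, QuasiIso ((((evaluation (Discrete J) C).obj j).mapHomologicalComplex c).map f)) :
    QuasiIso f := by
  rw [quasiIso_iff]
  intro n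
  rw [quasiIsoAt_iff_isIso_homologyMap, NatTrans.isIso_iff_isIso_app]
  intro j
  let E := (evaluation (Discrete J) C).obj j
  have h1 := (h j).quasiIsoAt n
  rw [quasiIsoAt_iff, ShortComplex.quasiIso_iff] at h1
  have h2 := ShortComplex.mapHomologyIso_hom_naturality (F := E)
    ((shortComplexFunctor (Discrete J ⥤ C) c n).map f)
  have h3 : IsIso (ShortComplex.homologyMap
    (E.mapShortComplex.map ((shortComplexFunctor (Discrete J ⥤ C) c n).map f))) := h1
  exact isIso_of_comp_iso_eq h3 _ _ h2

variable [HasCoproductsOfShape J C]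

/-- The coproduct of a family of complexes, computed degreewise. -/
@[simps]
abbrev sigmaComplex (K : J → HomologicalComplex C c) : HomologicalComplex C c where
  X n := ∐ fun j => (K j).X n
  d n m := Limits.Sigma.map fun j => (K j).d n m
  shape n m h := by
    refine Limits.Sigma.hom_ext _ _ fun j => ?_
    simp [(K j).shape n m h]
  d_comp_d' n m k _ _ := by
    refine Limits.Sigma.hom_ext _ _ fun j => ?_
    simp

/-- The coproduct of a family of morphisms of complexes. -/
@[simps]
def sigmaComplexMap {K L : J → HomologicalComplex C c} (f : ∀ j, K j ⟶ L j) :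
    sigmaComplex K ⟶ sigmaComplex L where
  f n := Limits.Sigma.map fun j => (f j).f n
  comm' n m _ := by
    refine Limits.Sigma.hom_ext _ _ fun j => ?_
    simp

/-- The inclusions into the coproduct. -/
@[simps]
def sigmaComplexι (K : J → HomologicalComplex C c) (j : J) : K j ⟶ sigmaComplex K where
  f n := Limits.Sigma.ι (fun j => (K j).X n) j
  comm' n m _ := by simp

theorem sigmaComplexι_map {K L : J → HomologicalComplex C c} (f : ∀ j, K j ⟶ L j) (j : J) :
    sigmaComplexι K j ≫ sigmaComplexMap f = f j ≫ sigmaComplexι L j := by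
  ext n
  simp

/-- The morphism from the coproduct induced by a family of morphisms. -/
@[simps]
def sigmaComplexDesc (K : J → HomologicalComplex C c) {L : HomologicalComplex C c}
    (f : ∀ j, K j ⟶ L) : sigmaComplex K ⟶ L where
  f n := Limits.Sigma.desc fun j => (f j).f n
  comm' n m _ := by
    refine Limits.Sigma.hom_ext _ _ fun j => ?_
    simp

theorem sigmaComplexι_desc (K : J → HomologicalComplex C c) {L : HomologicalComplex C c}
    (f : ∀ j, K j ⟶ L) (j : J) : sigmaComplexι K j ≫ sigmaComplexDesc K f = f j := by
  ext n
  simp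

/-- The degreewise coproduct is a coproduct in the category of complexes. -/
def sigmaComplexIsColimit (K : J → HomologicalComplex C c) :
    IsColimit (Cofan.mk (sigmaComplex K) (sigmaComplexι K)) :=
  Cofan.IsColimit.mk _ (fun s => sigmaComplexDesc K s.inj)
    (fun s j => sigmaComplexι_desc K _ j)
    (fun s m hm => by
      ext n
      refine Limits.Sigma.hom_ext _ _ fun j => ?_
      have := congrArg (fun t => Hom.f t n) (hm j)
      simpa using this)

/-- A morphism from a coproduct of complexes is homotopic to zero if its components are. -/
def homotopyZeroOfSigma (K : J → HomologicalComplex C c) {L : HomologicalComplex C c}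
    (f : sigmaComplex K ⟶ L) (h : ∀ j, Homotopy (sigmaComplexι K j ≫ f) 0) : Homotopy f 0 where
  hom n m := Limits.Sigma.desc fun j => (h j).hom n m
  zero n m hnm := by
    refine Limits.Sigma.hom_ext _ _ fun j => ?_
    simp [(h j).zero n m hnm]
  comm n := by
    refine Limits.Sigma.hom_ext _ _ fun j => ?_
    have := (h j).comm n
    simp only [comp_f, sigmaComplexι_f, zero_f, add_zero] at this
    rw [this]
    simp [dNext, prevD, Preadditive.comp_add]

theorem quasiIso_sigmaComplexMap [HasExactColimitsOfShape (Discrete J) C]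
    {K L : J → HomologicalComplex C c} (f : ∀ j, K j ⟶ L j) (hf : ∀ j, QuasiIso (f j)) :
    QuasiIso (sigmaComplexMap f) := by
  have : QuasiIso (familyMap f) := quasiIso_of_evaluation _ fun j => hf j.as
  have : PreservesFiniteLimits (colim (J := Discrete J) (C := C)) :=
    HasExactColimitsOfShape.preservesFiniteLimits
  -- The degreewise coproduct is by definition the functor `colim` applied to the complex of
  -- families, and exact functors preserve quasi-isomorphisms.
  exact inferInstanceAs (QuasiIso
    (((colim (J := Discrete J) (C := C)).mapHomologicalComplex c).map (familyMap f)))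

end HomologicalComplex

namespace DerivedCategory

open HomologicalComplex

variable [HasDerivedCategory.{w} C]

theorem exists_iso_comp_Q (F : Discrete J ⥤ DerivedCategory C) :
    ∃ K : J → CochainComplex C ℤ, Nonempty (Discrete.functor K ⋙ Q ≅ F) :=
  ⟨fun j => Q.objPreimage (F.obj ⟨j⟩),
    ⟨Discrete.natIso fun j => Q.objObjPreimageIso (F.obj j)⟩⟩

/-- Calculus of fractions in the homotopy category: a map that dies after localization dies after
precomposition with a quasi-isomorphism. -/
theorem exists_homotopy_of_Q_map_eq_zero {X Y : CochainComplex C ℤ} (f : X ⟶ Y)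
    (hf : Q.map f = 0) : ∃ (X' : CochainComplex C ℤ) (t : X' ⟶ X) (_ : IsIso (Q.map t)),
      Nonempty (Homotopy (t ≫ f) 0) := by
  let q := HomotopyCategory.quotient C (ComplexShape.up ℤ)
  have h0 : Qh.map (q.map f) = Qh.map (q.map (0 : X ⟶ Y)) := by
    have h1 := quotientCompQhIso_hom_naturality f
    have h2 := quotientCompQhIso_hom_naturality (0 : X ⟶ Y)
    rw [hf, comp_zero] at h1
    rw [Q.map_zero, comp_zero] at h2
    exact (cancel_mono ((quotientCompQhIso C).hom.app Y)).1 (h1.trans h2.symm)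
  obtain ⟨Z, s, hs, h⟩ := (MorphismProperty.map_eq_iff_precomp Qh
    (HomotopyCategory.quasiIso C (ComplexShape.up ℤ)) _ _).1 h0
  obtain ⟨X', rfl⟩ := HomotopyCategory.quotient_obj_surjective Z
  obtain ⟨t, rfl⟩ := (HomotopyCategory.quotient _ _).map_surjective s
  rw [← isIso_Qh_map_iff] at hs
  refine ⟨X', t, hs, ⟨HomotopyCategory.homotopyOfEq _ _ ?_⟩⟩
  rw [Functor.map_comp, h, ← Functor.map_comp, comp_zero]

variable [HasCoproductsOfShape J C] [HasExactColimitsOfShape (Discrete J) C]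

theorem isIso_Q_map_sigmaComplexMap {K L : J → CochainComplex C ℤ} (f : ∀ j, K j ⟶ L j)
    (hf : ∀ j, IsIso (Q.map (f j))) : IsIso (Q.map (sigmaComplexMap f)) := by
  rw [isIso_Q_map_iff_quasiIso C (sigmaComplexMap f)]
  exact quasiIso_sigmaComplexMap f fun j => (isIso_Q_map_iff_quasiIso C (f j)).1 (hf j)

/-- After writing the map as a fraction, each component becomes null-homotopic on a quasi-isomorphic
replacement. The homotopies assemble on the coproduct of the replacements, which is still
quasi-isomorphic to the original. -/
theorem Q_map_sigma_hom_ext_zero (K : J → CochainComplex C ℤ) {Y : DerivedCategory C}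
    (f : Q.obj (sigmaComplex K) ⟶ Y) (hf : ∀ j, Q.map (sigmaComplexι K j) ≫ f = 0) : f = 0 := by
  obtain ⟨Y, ⟨e⟩⟩ : ∃ Y', Nonempty (Y ≅ Q.obj Y') :=
    ⟨Q.objPreimage Y, ⟨(Q.objObjPreimageIso Y).symm⟩⟩
  rw [← cancel_mono e.hom, zero_comp]
  obtain ⟨Y', g, s, hs, h⟩ := left_fac (f ≫ e.hom)
  rw [h]
  suffices Q.map g = 0 by rw [this, zero_comp]
  have hg : ∀ j, Q.map (sigmaComplexι K j ≫ g) = 0 := fun j => by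
    rw [← cancel_mono (inv (Q.map s)), Functor.map_comp, Category.assoc, ← h, zero_comp,
      ← Category.assoc, hf, zero_comp]
  choose X t ht hh using fun j => exists_homotopy_of_Q_map_eq_zero _ (hg j)
  have := isIso_Q_map_sigmaComplexMap t ht
  rw [← cancel_epi (Q.map (sigmaComplexMap t)), comp_zero, ← Functor.map_comp]
  have H : Homotopy (sigmaComplexMap t ≫ g) 0 := homotopyZeroOfSigma X _ fun j =>
    (Homotopy.ofEq (by rw [← Category.assoc, sigmaComplexι_map, Category.assoc])).trans
      (hh j).some
  rw [Q_map_eq_of_homotopy C H, Q.map_zero]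

theorem exists_Q_sigma_desc (K : J → CochainComplex C ℤ) {Y : DerivedCategory C}
    (f : ∀ j, Q.obj (K j) ⟶ Y) :
    ∃ g : Q.obj (sigmaComplex K) ⟶ Y, ∀ j, Q.map (sigmaComplexι K j) ≫ g = f j := by
  obtain ⟨Y, ⟨e⟩⟩ : ∃ Y', Nonempty (Y ≅ Q.obj Y') :=
    ⟨Q.objPreimage Y, ⟨(Q.objObjPreimageIso Y).symm⟩⟩
  choose X t ht g hg using fun j => right_fac (f j ≫ e.hom)
  have := isIso_Q_map_sigmaComplexMap t ht
  refine ⟨inv (Q.map (sigmaComplexMap t)) ≫ Q.map (sigmaComplexDesc X g) ≫ e.inv, fun j => ?_⟩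
  have h1 : Q.map (sigmaComplexι K j) ≫ inv (Q.map (sigmaComplexMap t)) =
      inv (Q.map (t j)) ≫ Q.map (sigmaComplexι X j) := by
    rw [IsIso.comp_inv_eq, Category.assoc, ← Functor.map_comp, sigmaComplexι_map,
      Functor.map_comp, IsIso.inv_hom_id_assoc]
  rw [← Category.assoc, h1, Category.assoc, ← Category.assoc (Q.map _), ← Functor.map_comp,
    sigmaComplexι_desc, ← Category.assoc, ← hg, Category.assoc, e.hom_inv_id, Category.comp_id]

/-- The localization functor `Q` preserves the degreewise coproducts. -/
def QSigmaIsColimit (K : J → CochainComplex C ℤ) :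
    IsColimit (Cofan.mk (Q.obj (sigmaComplex K)) fun j => Q.map (sigmaComplexι K j)) :=
  Cofan.IsColimit.mk _ (fun s => (exists_Q_sigma_desc K s.inj).choose)
    (fun s j => (exists_Q_sigma_desc K s.inj).choose_spec j)
    (fun s m hm => by
      rw [← sub_eq_zero]
      refine Q_map_sigma_hom_ext_zero K _ fun j => ?_
      rw [Preadditive.comp_sub, (exists_Q_sigma_desc K s.inj).choose_spec j, sub_eq_zero]
      exact hm j)

instance preservesColimitsOfShape_Q :
    PreservesColimitsOfShape (Discrete J) (Q : CochainComplex C ℤ ⥤ DerivedCategory C) := by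
  have : ∀ K : J → CochainComplex C ℤ, PreservesColimit (Discrete.functor K)
      (Q : CochainComplex C ℤ ⥤ DerivedCategory C) := fun K =>
    preservesColimit_of_preserves_colimit_cocone (sigmaComplexIsColimit K)
      ((isColimitMapCoconeCofanMkEquiv Q _ _).symm (QSigmaIsColimit K))
  exact preservesColimitsOfShape_of_discrete Q

instance hasCoproductsOfShape : HasCoproductsOfShape J (DerivedCategory C) where
  has_colimit F := by
    obtain ⟨K, ⟨e⟩⟩ := exists_iso_comp_Q F
    have : HasColimit (Discrete.functor K ⋙ (Q : CochainComplex C ℤ ⥤ DerivedCategory C)) :=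
      ⟨⟨_, isColimitOfPreserves Q (sigmaComplexIsColimit K)⟩⟩
    exact hasColimit_of_iso e.symm

theorem preservesColimitsOfShape_of_comp_Q {D : Type*} [Category D] (G : DerivedCategory C ⥤ D)
    [PreservesColimitsOfShape (Discrete J) (Q ⋙ G)] : PreservesColimitsOfShape (Discrete J) G where
  preservesColimit {F} := by
    obtain ⟨K, ⟨e⟩⟩ := exists_iso_comp_Q F
    have : PreservesColimit (Discrete.functor K ⋙ Q) G :=
      preservesColimit_of_preserves_colimit_cocone
        (isColimitOfPreserves Q (sigmaComplexIsColimit K))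
        (isColimitOfPreserves (Q ⋙ G) (sigmaComplexIsColimit K))
    exact preservesColimit_of_iso_diagram G e

instance preservesColimitsOfShape_mapDerivedCategory (F : C ⥤ C) [F.Additive]
    [PreservesFiniteLimits F] [PreservesFiniteColimits F]
    [PreservesColimitsOfShape (Discrete J) F] :
    PreservesColimitsOfShape (Discrete J) F.mapDerivedCategory := by
  have : PreservesColimitsOfShape (Discrete J) (F.mapHomologicalComplex (ComplexShape.up ℤ)) :=
    preservesColimitsOfShape_of_eval _ fun i =>
      inferInstanceAs (PreservesColimitsOfShape (Discrete J) (eval C _ i ⋙ F))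
  have := preservesColimitsOfShape_of_natIso (J := Discrete J) F.mapDerivedCategoryFactors.symm
  exact preservesColimitsOfShape_of_comp_Q _

end DerivedCategory

end DerivedCoproducts


/-! ### From a colocalization to its complementary localization -/

section Bousfield

open Pretriangulated

theorem isClosedUnderColimitsOfShape_functorKernel {T : Type u} [Category.{v} T] [HasZeroMorphisms T] (F : T ⥤ T) (J : Type w)
   
    [PreservesColimitsOfShape (Discrete J) F] :
    (functorKernel F).IsClosedUnderColimitsOfShape (Discrete J) where
  colimitsOfShape_le := by
    rintro X ⟨h⟩
    change IsZero (F.obj X)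
    rw [IsZero.iff_id_eq_zero]
    refine (isColimitOfPreserves F h.isColimit).hom_ext fun j => ?_
    exact (h.prop_diag_obj j : IsZero (F.obj _)).eq_of_src _ _

/-- Naturality of `ε` factors `ε ≫ f` through `Γ.map f`, which has zero target; so objects in the
image of `Γ` are left orthogonal to its kernel. -/
theorem eq_zero_of_isZero_colocalization {T : Type u} [Category.{v} T] [HasZeroMorphisms T]
    (Γ : T ⥤ T) (ε : Γ ⟶ 𝟭 T) (hε' : ∀ X, IsIso (ε.app (Γ.obj X))) {X Y : T}
    (hY : IsZero (Γ.obj Y)) (f : Γ.obj X ⟶ Y) :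
    f = 0 := by
  have := hε' X
  rw [← cancel_epi (ε.app (Γ.obj X)), comp_zero]
  have h := ε.naturality f
  rw [hY.eq_of_tgt (Γ.map f) 0, zero_comp] at h
  exact h.symm

variable {T : Type u} [Category.{v} T] [HasZeroObject T] [HasShift T ℤ] [Preadditive T]
  [∀ n : ℤ, (shiftFunctor T n).Additive] [Pretriangulated T]

section Kernel

variable (F : T ⥤ T)

instance isTriangulated_functorKernel [F.CommShift ℤ] [F.IsTriangulated] :
    (functorKernel F).IsTriangulated where
  exists_zero := by
    obtain ⟨Z, hZ⟩ := HasZeroObject.zero (C := T)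
    exact ⟨Z, hZ, F.map_isZero hZ⟩
  isStableUnderShiftBy n := ⟨fun X (hX : IsZero (F.obj X)) =>
    ((shiftFunctor T n).map_isZero hX).of_iso ((F.commShiftIso n).app X)⟩
  ext₂' A hA h₁ h₃ := ObjectProperty.le_isoClosure _ _
    (Triangle.isZero₂_of_isZero₁₃ _ (F.map_distinguished A hA) h₁ h₃)

theorem isLocalizingSubcategory_functorKernel [F.CommShift ℤ] [F.IsTriangulated]
    (h : ∀ J : Type w, PreservesColimitsOfShape (Discrete J) F) :
    IsLocalizingSubcategory.{w} (functorKernel F) where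
  triangulated := inferInstance
  summands := ⟨fun {X Y} r (hY : IsZero (F.obj Y)) => by
    change IsZero (F.obj X)
    rw [IsZero.iff_id_eq_zero, ← (r.map F).retract, hY.eq_of_tgt (r.map F).i 0, zero_comp]⟩
  coproducts J := isClosedUnderColimitsOfShape_functorKernel F J

end Kernel

variable (Γ : T ⥤ T) [Γ.CommShift ℤ] [Γ.IsTriangulated] (ε : Γ ⟶ 𝟭 T)
  (hε : ∀ X, IsIso (Γ.map (ε.app X))) (hε' : ∀ X, IsIso (ε.app (Γ.obj X)))

include hε hε' in
/-- A triangulated coproduct preserving idempotent comonad `Γ` has a complementary coproduct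
preserving localization functor, whose kernel consists of the objects on which the counit is an
isomorphism. -/
theorem exists_isLocalizationFunctor_of_colocalization
    [∀ J : Type w, HasCoproductsOfShape J T]
    [∀ J : Type w, PreservesColimitsOfShape (Discrete J) Γ] :
    ∃ L : T ⥤ T, IsLocalizationFunctor L ∧
      (∀ J : Type w, PreservesColimitsOfShape (Discrete J) L) ∧
      IsLocalizingSubcategory.{w} (functorKernel L) ∧
      ∀ X, functorKernel L X ↔ IsIso (ε.app X) := by
  choose Z g h hT using fun X => distinguished_cocone_triangle (ε.app X)
  let N := functorKernel Γ
  have hN : ∀ J : Type w, N.IsClosedUnderColimitsOfShape (Discrete J) := fun J =>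
    isClosedUnderColimitsOfShape_functorKernel Γ J
  have hZ : ∀ X, N (Z X) := fun X =>
    (Triangle.isZero₃_iff_isIso₁ _ (Γ.map_distinguished _ (hT X))).2 (hε X)
  -- The map `g X` to the cone is universal among maps from `X` to `N`. Existence uses that `Γ X`
  -- has no maps to `N`, uniqueness that its shift, isomorphic to `Γ` of a shift, has none.
  have fac : ∀ {X Y : T} (_ : N Y) (k : X ⟶ Y), ∃ m : Z X ⟶ Y, g X ≫ m = k := fun hY k => by
    obtain ⟨m, hm⟩ := Triangle.yoneda_exact₂ _ (hT _) k
      (eq_zero_of_isZero_colocalization Γ ε hε' hY _)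
    exact ⟨m, hm.symm⟩
  have uniq : ∀ {X Y : T} (_ : N Y) (k : Z X ⟶ Y), g X ≫ k = 0 → k = 0 := fun {X Y} hY k hk => by
    obtain ⟨m, rfl⟩ : ∃ m : (Γ.obj X)⟦(1 : ℤ)⟧ ⟶ Y, k = h X ≫ m :=
      Triangle.yoneda_exact₃ _ (hT X) k hk
    have hm := eq_zero_of_isZero_colocalization Γ ε hε' hY
      ((Γ.commShiftIso (1 : ℤ)).hom.app X ≫ m)
    rw [(cancel_epi ((Γ.commShiftIso (1 : ℤ)).hom.app X)).1 (hm.trans comp_zero.symm), comp_zero]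
  have bij : ∀ (X : T) (Y : N.FullSubcategory),
      Function.Bijective (fun k : (⟨Z X, hZ X⟩ : N.FullSubcategory) ⟶ Y => g X ≫ N.ι.map k) := by
    intro X Y
    constructor
    · intro k l hkl
      have h0 : g X ≫ (N.ι.map k - N.ι.map l) = 0 :=
        (Preadditive.comp_sub _ _ _).trans (sub_eq_zero.2 hkl)
      exact N.ι.map_injective (sub_eq_zero.1 (uniq Y.property _ h0))
    · intro k
      obtain ⟨m, hm⟩ := fac Y.property k
      exact ⟨N.ι.preimage m, (congrArg (g X ≫ ·) (N.ι.map_preimage (X := ⟨Z X, hZ X⟩) m)).trans hm⟩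
  let e : ∀ (X : T) (Y : N.FullSubcategory), ((⟨Z X, hZ X⟩ : N.FullSubcategory) ⟶ Y) ≃
      (X ⟶ N.ι.obj Y) := fun X Y => Equiv.ofBijective _ (bij X Y)
  have he : ∀ X Y Y' (k : Y ⟶ Y') (l : (⟨Z X, hZ X⟩ : N.FullSubcategory) ⟶ Y),
      e X Y' (l ≫ k) = e X Y l ≫ N.ι.map k := fun X Y Y' k l => by
    simp [e]
  -- The universal property makes the objectwise chosen cones functorial, and being left adjoint to
  -- a triangulated inclusion makes `R` exact.
  let R : T ⥤ N.FullSubcategory := Adjunction.leftAdjointOfEquiv e he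
  let adj : R ⊣ N.ι := Adjunction.adjunctionOfEquivLeft e he
  let _ : R.CommShift ℤ := adj.leftAdjointCommShift ℤ
  have _ : adj.CommShift ℤ := adj.commShift_of_rightAdjoint ℤ
  have _ : R.IsTriangulated := adj.isTriangulated_leftAdjoint
  let _ : Reflective N.ι := { L := R, adj := adj }
  have hL : ∀ J : Type w, PreservesColimitsOfShape (Discrete J) (R ⋙ N.ι) := fun J => by
    have := hN J
    have : PreservesColimitsOfShape (Discrete J) R := adj.leftAdjoint_preservesColimits.1
    infer_instance
  refine ⟨R ⋙ N.ι, ⟨⟨inferInstance, inferInstance⟩, ⟨adj.unit, fun X => ?_⟩⟩, hL,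
    isLocalizingSubcategory_functorKernel _ hL, fun X => ?_⟩
  · have h1 : adj.unit.app (N.ι.obj (R.obj X)) = N.ι.map (R.map (adj.unit.app X)) :=
      unit_obj_eq_map_unit (i := N.ι) X
    have h2 : IsIso (adj.unit.app (N.ι.obj (R.obj X))) :=
      Functor.essImage.unit_isIso (i := N.ι) ⟨_, ⟨Iso.refl _⟩⟩
    exact ⟨h1 ▸ h2, h1.symm⟩
  · exact Triangle.isZero₃_iff_isIso₁ _ (hT X)

end Bousfield


/-! ### Passing an exact functor over the identity to the derived category -/

section ExactColocalization

variable {C : Type u} [Category.{v} C] [Abelian C]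

/-- The natural transformation `F ⟶ 𝟭` applied degreewise to complexes. -/
@[simps]
def HomologicalComplex.mapToId {ι : Type*} (c : ComplexShape ι) {F : C ⥤ C}
    [F.PreservesZeroMorphisms] (τ : F ⟶ 𝟭 C) :
    F.mapHomologicalComplex c ⟶ 𝟭 (HomologicalComplex C c) where
  app K :=
    { f := fun i => τ.app (K.X i)
      comm' := fun i j _ => (τ.naturality (K.d i j)).symm }
  naturality K L f := by
    ext i
    exact τ.naturality (f.f i)

/-- Exactness identifies `F` of the homology with the homology of `F K`, turning `τ` at the homology
into the map induced by `τ` on complexes. -/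
theorem HomologicalComplex.isIso_app_homology_of_quasiIso {ι : Type*} {c : ComplexShape ι}
    {F : C ⥤ C} [F.Additive] [PreservesFiniteLimits F] [PreservesFiniteColimits F] (τ : F ⟶ 𝟭 C)
    (K : HomologicalComplex C c) (h : QuasiIso ((mapToId c τ).app K)) (n : ι) :
    IsIso (τ.app (K.homology n)) := by
  have h1 := h.quasiIsoAt n
  rw [quasiIsoAt_iff, ShortComplex.quasiIso_iff] at h1
  have h2 := NatTrans.app_homology τ (K.sc n)
  have h3 : IsIso (ShortComplex.homologyMap ((K.sc n).mapNatTrans τ)) := h1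
  have h4 : IsIso (τ.app (K.sc n).homology) := by
    rw [h2]
    infer_instance
  exact h4

namespace DerivedCategory

open HomologicalComplex

variable [HasDerivedCategory.{w} C]
variable (F : C ⥤ C) [F.Additive] [PreservesFiniteLimits F] [PreservesFiniteColimits F]
  (τ : F ⟶ 𝟭 C)

/-- The natural transformation from an exact functor to the identity, on the derived category. -/
def mapDerivedCategoryToId : F.mapDerivedCategory ⟶ 𝟭 (DerivedCategory C) :=
  Localization.liftNatTrans Q (quasiIso C (ComplexShape.up ℤ))
    (F.mapHomologicalComplex (ComplexShape.up ℤ) ⋙ Q) Q _ _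
    (Functor.whiskerRight (mapToId (ComplexShape.up ℤ) τ) Q)

theorem mapDerivedCategoryToId_app_Q (K : CochainComplex C ℤ) :
    (mapDerivedCategoryToId F τ).app (Q.obj K) =
      F.mapDerivedCategoryFactors.hom.app K ≫ Q.map ((mapToId _ τ).app K) := by
  refine (Localization.liftNatTrans_app _ _ _ _ _ _ _ _).trans ?_
  rw [← Category.assoc]
  exact Category.comp_id _

theorem isIso_mapDerivedCategoryToId_app_Q (K : CochainComplex C ℤ) :
    IsIso ((mapDerivedCategoryToId F τ).app (Q.obj K)) ↔
      QuasiIso ((mapToId (ComplexShape.up ℤ) τ).app K) := by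
  rw [mapDerivedCategoryToId_app_Q, isIso_comp_left_iff, isIso_Q_map_iff_quasiIso]

theorem isIso_map_mapDerivedCategoryToId_app (h : ∀ X, IsIso (F.map (τ.app X)))
    (X : DerivedCategory C) :
    IsIso (F.mapDerivedCategory.map ((mapDerivedCategoryToId F τ).app X)) := by
  let K := Q.objPreimage X
  refine (NatTrans.isIso_app_iff_of_iso
    (Functor.whiskerRight (mapDerivedCategoryToId F τ) F.mapDerivedCategory)
    (Q.objObjPreimageIso X)).1 ?_
  change IsIso (F.mapDerivedCategory.map ((mapDerivedCategoryToId F τ).app (Q.obj K)))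
  rw [mapDerivedCategoryToId_app_Q, Functor.map_comp, isIso_comp_left_iff,
    ← isIso_comp_right_iff _ (F.mapDerivedCategoryFactors.hom.app K)]
  have : IsIso ((F.mapHomologicalComplex (ComplexShape.up ℤ)).map
      ((mapToId (ComplexShape.up ℤ) τ).app K)) := by
    have : ∀ i, IsIso (((F.mapHomologicalComplex (ComplexShape.up ℤ)).map
      ((mapToId (ComplexShape.up ℤ) τ).app K)).f i) := fun i => h (K.X i)
    exact Hom.isIso_of_components _
  exact (F.mapDerivedCategoryFactors_hom_naturality ((mapToId _ τ).app K)) ▸ inferInstance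

theorem isIso_mapDerivedCategoryToId_app_obj (h : ∀ X, IsIso (τ.app (F.obj X)))
    (X : DerivedCategory C) :
    IsIso ((mapDerivedCategoryToId F τ).app (F.mapDerivedCategory.obj X)) := by
  let K := Q.objPreimage X
  refine (NatTrans.isIso_app_iff_of_iso _ ((F.mapDerivedCategoryFactors.app K).symm ≪≫
    F.mapDerivedCategory.mapIso (Q.objObjPreimageIso X))).1 ?_
  have : ∀ i, IsIso (((mapToId (ComplexShape.up ℤ) τ).app
    ((F.mapHomologicalComplex (ComplexShape.up ℤ)).obj K)).f i) := fun i => h (K.X i)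
  have : IsIso ((mapToId (ComplexShape.up ℤ) τ).app
    ((F.mapHomologicalComplex (ComplexShape.up ℤ)).obj K)) := Hom.isIso_of_components _
  exact (isIso_mapDerivedCategoryToId_app_Q F τ _).2 inferInstance

end DerivedCategory

end ExactColocalization


/-! ### Tensoring with a flat idempotent ideal -/

section IdempotentIdeal

open MonoidalCategory

theorem isIso_whiskerLeft_whiskerRight_comp_leftUnitor {C : Type*} [Category C]
    [MonoidalCategory C] {M : C} (i : M ⟶ 𝟙_ C) (h : IsIso (M ◁ i)) (X : C) :
    IsIso (M ◁ (i ▷ X ≫ (λ_ X).hom)) := by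
  have : M ◁ (i ▷ X) = (α_ _ _ _).inv ≫ (M ◁ i) ▷ X ≫ (α_ _ _ _).hom := by simp
  rw [MonoidalCategory.whiskerLeft_comp, this]
  infer_instance

theorem isIso_whiskerRight_tensor_comp_leftUnitor {C : Type*} [Category C]
    [MonoidalCategory C] [BraidedCategory C] {M : C} (i : M ⟶ 𝟙_ C) (h : IsIso (M ◁ i)) (X : C) :
    IsIso (i ▷ (M ⊗ X) ≫ (λ_ (M ⊗ X)).hom) := by
  have h1 : i ▷ M = ((β_ M M).hom ≫ M ◁ i) ≫ (β_ (𝟙_ C) M).inv := by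
    rw [Iso.eq_comp_inv]
    exact BraidedCategory.braiding_naturality_left i M
  have h2 : IsIso (i ▷ M) := by
    rw [h1]
    infer_instance
  rw [MonoidalCategory.whiskerRight_tensor]
  infer_instance

variable {A : Type u} [CommRing A]

/-- The multiplication map `I ⊗ M ⟶ M`. -/
def Ideal.tensorLeftToId (I : Ideal A) : tensorLeft (ModuleCat.of A I) ⟶ 𝟭 (ModuleCat.{u} A) :=
  (tensoringLeft (ModuleCat.{u} A)).map (ModuleCat.ofHom I.subtype : ModuleCat.of A I ⟶ 𝟙_ _) ≫
    (leftUnitorNatIso (ModuleCat.{u} A)).hom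

theorem Ideal.tensorLeftToId_app_mem (I : Ideal A) (M : ModuleCat.{u} A)
    (x : TensorProduct A I M) :
    (I.tensorLeftToId.app M).hom x ∈ I • (⊤ : Submodule A M) := by
  induction x using TensorProduct.induction_on with
  | zero => exact (map_zero (I.tensorLeftToId.app M).hom) ▸ zero_mem _
  | add x y hx hy => exact (map_add (I.tensorLeftToId.app M).hom x y) ▸ add_mem hx hy
  | tmul a x => exact Submodule.smul_mem_smul a.2 trivial

variable (I : Ideal A) [Module.Flat A I]
  (hI : ∀ a ∈ I, ∃ b ∈ I, ∃ c ∈ I, b * c = a)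

include hI in
-- Flatness gives injectivity of `I ⊗ I → I ⊗ A`, and factoring elements of `I` inside `I` gives
-- surjectivity.
theorem Ideal.isIso_whiskerLeft_subtype :
    IsIso (ModuleCat.of A I ◁
      (ModuleCat.ofHom I.subtype : ModuleCat.of A I ⟶ 𝟙_ (ModuleCat.{u} A))) := by
  rw [ConcreteCategory.isIso_iff_bijective]
  constructor
  · exact Module.Flat.lTensor_preserves_injective_linearMap (M := I) I.subtype
      (Submodule.subtype_injective I)
  · change Function.Surjective (LinearMap.lTensor I I.subtype)
    intro x
    induction x using TensorProduct.induction_on with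
    | zero => exact ⟨0, map_zero _⟩
    | add x y hx hy =>
      obtain ⟨x, rfl⟩ := hx
      obtain ⟨y, rfl⟩ := hy
      exact ⟨x + y, map_add _ _ _⟩
    | tmul a r =>
      obtain ⟨b, hb, c, hc, h⟩ := hI (r * a) (I.mul_mem_left r a.2)
      -- With `r * a = b * c`, one has `a ⊗ r = (b * c) ⊗ 1 = c ⊗ b`.
      refine ⟨TensorProduct.tmul A ⟨c, hc⟩ ⟨b, hb⟩, ?_⟩
      rw [LinearMap.lTensor_tmul]
      have h1 : (a : I) ⊗ₜ[A] r = (r • a) ⊗ₜ[A] (1 : A) := by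
        rw [TensorProduct.smul_tmul, smul_eq_mul, mul_one]
      have h2 : r • a = b • (⟨c, hc⟩ : I) := Subtype.ext h.symm
      rw [h1, h2, TensorProduct.smul_tmul, smul_eq_mul, mul_one]
      rfl

include hI in
theorem Ideal.isIso_tensorLeft_map_tensorLeftToId (M : ModuleCat.{u} A) :
    IsIso ((tensorLeft (ModuleCat.of A I)).map (I.tensorLeftToId.app M)) :=
  isIso_whiskerLeft_whiskerRight_comp_leftUnitor _ (I.isIso_whiskerLeft_subtype hI) M

include hI in
theorem Ideal.isIso_tensorLeftToId_app_tensorLeft (M : ModuleCat.{u} A) :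
    IsIso (I.tensorLeftToId.app ((tensorLeft (ModuleCat.of A I)).obj M)) :=
  isIso_whiskerRight_tensor_comp_leftUnitor _ (I.isIso_whiskerLeft_subtype hI) M

end IdempotentIdeal

/-! ### Perfect complexes and Nakayama -/

section Perfect

variable {A : Type u} [CommRing A]

/-- Surjectivity of `I ⊗ M → M` means `M = I M`, so Nakayama applies. -/
theorem ModuleCat.isZero_of_isIso_tensorLeftToId (I : Ideal A) (hI : I ≤ Ideal.jacobson ⊥)
    (M : ModuleCat.{u} A) [Module.Finite A M] (h : IsIso (I.tensorLeftToId.app M)) :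
    IsZero M := by
  have hsurj := ((ConcreteCategory.isIso_iff_bijective _).1 h).2
  have htop : (⊤ : Submodule A M) ≤ I • ⊤ := fun x _ => by
    obtain ⟨y, rfl⟩ := hsurj x
    exact I.tensorLeftToId_app_mem M y
  have := Submodule.eq_bot_of_le_smul_of_le_jacobson_bot I ⊤ Module.Finite.fg_top htop hI
  rw [ModuleCat.isZero_iff_subsingleton]
  exact (Submodule.subsingleton_iff A).1 (subsingleton_of_bot_eq_top this.symm)

/-- Homology need not be finitely generated a priori, so the argument descends from the top. Once
the cycles in degree `n + 1` are finitely generated projective, the homology there vanishes, the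
differential onto those cycles splits, and the cycles in degree `n` are a summand of `K.X n`. -/
theorem HomologicalComplex.exactAt_of_bounded_of_finite_of_projective
    (K : CochainComplex (ModuleCat.{u} A) ℤ) (b : ℤ) (hb : ∀ i, b < i → IsZero (K.X i))
    (hK : ∀ i, Module.Finite A (K.X i) ∧ Module.Projective A (K.X i))
    (h : ∀ n, Module.Finite A (K.homology n) → IsZero (K.homology n)) (n : ℤ) :
    K.ExactAt n := by
  have hex : ∀ n, Module.Finite A (K.cycles n) → K.ExactAt n := fun n hn => by
    rw [K.exactAt_iff_isZero_homology]
    apply h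
    exact Module.Finite.of_surjective (K.homologyπ n).hom
      ((ModuleCat.epi_iff_surjective _).1 inferInstance)
  have hretract : ∀ n, Nonempty (Retract (K.cycles n) (K.X n)) →
      Module.Finite A (K.cycles n) ∧ Projective (K.cycles n) := fun n ⟨r⟩ => by
    have := (hK n).1
    have hp : Projective (K.X n) := (IsProjective.iff_projective (R := A) (K.X n)).1 (hK n).2
    refine ⟨Module.Finite.of_surjective r.r.hom
      ((ModuleCat.epi_iff_surjective _).1 inferInstance), r.projective⟩
  have hstep : ∀ n, Module.Finite A (K.cycles (n + 1)) ∧ Projective (K.cycles (n + 1)) →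
      Module.Finite A (K.cycles n) ∧ Projective (K.cycles n) := by
    rintro n ⟨hf, hp⟩
    apply hretract
    have hepi : Epi (K.toCycles n (n + 1)) := by
      have := hex _ hf
      rw [K.exactAt_iff' n (n + 1) (n + 1 + 1) (by simp) (by simp),
        ShortComplex.exact_iff_epi_toCycles,
        ← K.toCycles_cyclesIsoSc'_hom n (n + 1) (n + 1 + 1) (by simp) (by simp)] at this
      exact (MorphismProperty.epimorphisms _).cancel_right_of_respectsIso _ _ |>.1 this
    let s := Projective.factorThru (𝟙 _) (K.toCycles n (n + 1))
    have hs : s ≫ K.toCycles n (n + 1) = 𝟙 _ := Projective.factorThru_comp _ _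
    -- With `s` a splitting of the differential `d` onto the next cycles, the endomorphism "identity
    -- minus `d` followed by `s`" lands in the cycles and restricts to the identity there.
    refine ⟨⟨K.iCycles n, K.liftCycles (𝟙 _ - K.toCycles n (n + 1) ≫ s) (n + 1) (by simp) ?_, ?_⟩⟩
    · rw [Preadditive.sub_comp, Category.id_comp, Category.assoc, ← K.toCycles_i n (n + 1),
        reassoc_of% hs, sub_self]
    · rw [← cancel_mono (K.iCycles n), Category.assoc, K.liftCycles_i, Preadditive.comp_sub,
        Category.comp_id, ← Category.assoc (K.iCycles n)]
      have : K.iCycles n ≫ K.toCycles n (n + 1) = 0 := by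
        rw [← cancel_mono (K.iCycles _)]
        simp
      rw [this, zero_comp, sub_zero, Category.id_comp]
  have hall : ∀ k : ℕ, ∀ n : ℤ, b < n + k →
      Module.Finite A (K.cycles n) ∧ Projective (K.cycles n) := by
    intro k
    induction k with
    | zero =>
      intro n hn
      refine hretract n ⟨⟨K.iCycles n, 0, ?_⟩⟩
      rw [← cancel_mono (K.iCycles n)]
      exact (hb n (by simpa using hn)).eq_of_tgt _ _
    | succ k ih =>
      intro n hn
      exact hstep n (ih (n + 1) (by push_cast at hn; linarith))
  exact hex n (hall (b + 1 - n).toNat n (by have := Int.self_le_toNat (b + 1 - n); linarith)).1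

end Perfect

/-! ### Failure of the telescope conjecture -/

section Telescope

open MonoidalCategory DerivedCategory ZeroObject

variable {A : Type u} [CommRing A]

theorem isZero_of_isPerfectComplex_of_isIso [HasDerivedCategory.{w} (ModuleCat.{u} A)]
    (I : Ideal A) [Module.Flat A I] (hI : I ≤ Ideal.jacobson ⊥)
    (X : DerivedCategory (ModuleCat.{u} A)) (hX : IsPerfectComplex A X)
    (h : IsIso ((mapDerivedCategoryToId _ I.tensorLeftToId).app X)) : IsZero X := by
  obtain ⟨K, ⟨_, b, hb⟩, hK, ⟨e⟩⟩ := hX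
  have hq := (isIso_mapDerivedCategoryToId_app_Q _ I.tensorLeftToId K).1
    ((NatTrans.isIso_app_iff_of_iso _ e).1 h)
  have hex := HomologicalComplex.exactAt_of_bounded_of_finite_of_projective K b
    (fun i hi => hb i (Or.inr hi)) hK fun n _ =>
      ModuleCat.isZero_of_isIso_tensorLeftToId I hI _
        (HomologicalComplex.isIso_app_homology_of_quasiIso I.tensorLeftToId K hq n)
  have hzero : IsZero (0 : CochainComplex (ModuleCat.{u} A) ℤ) := isZero_zero _
  have : QuasiIso (0 : K ⟶ 0) := by
    rw [quasiIso_iff]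
    intro n
    have h0 : (0 : CochainComplex (ModuleCat.{u} A) ℤ).ExactAt n := by
      rw [HomologicalComplex.exactAt_iff_isZero_homology]
      exact (HomologicalComplex.homologyFunctor _ _ n).map_isZero hzero
    exact (quasiIsoAt_iff_exactAt _ n (hex n)).2 h0
  exact (Q.map_isZero hzero).of_iso (e ≪≫ asIso (Q.map (0 : K ⟶ 0)))

/-- The telescope conjecture fails if there is a nonzero flat ideal `I = I²` contained in the
Jacobson radical. -/
theorem not_telescopeConjecture_of_ideal [HasDerivedCategory.{w} (ModuleCat.{u} A)]
    (I : Ideal A) [Module.Flat A I] (hI : I ≤ Ideal.jacobson ⊥) (hI₀ : I ≠ ⊥)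
    (hI₂ : ∀ a ∈ I, ∃ b ∈ I, ∃ c ∈ I, b * c = a) : ¬ TelescopeConjecture A := by
  intro htel
  let F := tensorLeft (ModuleCat.of A I)
  let Γ : DerivedCategory (ModuleCat.{u} A) ⥤ DerivedCategory (ModuleCat.{u} A) :=
    F.mapDerivedCategory
  let ε : Γ ⟶ 𝟭 _ := mapDerivedCategoryToId F I.tensorLeftToId
  have hε := isIso_map_mapDerivedCategoryToId_app F I.tensorLeftToId
    (I.isIso_tensorLeft_map_tensorLeftToId hI₂)
  have hε' := isIso_mapDerivedCategoryToId_app_obj F I.tensorLeftToId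
    (I.isIso_tensorLeftToId_app_tensorLeft hI₂)
  obtain ⟨L, hL, hLc, hLloc, hker⟩ :=
    exists_isLocalizationFunctor_of_colocalization.{u} Γ ε hε hε'
  -- The kernel of the identity functor is the zero subcategory. It contains every perfect complex
  -- of `functorKernel L`, so the conjecture would force `functorKernel L` to be zero.
  have hS := htel _ hLloc ⟨L, hL, hLc, rfl⟩ (functorKernel (𝟭 _))
    (isLocalizingSubcategory_functorKernel _ fun _ => inferInstance)
    (fun X hX => (hker X).2 (isIso_of_source_target_iso_zero _
      (IsZero.isoZero (Γ.map_isZero hX)) (IsZero.isoZero hX)))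
    (fun X hX hp => isZero_of_isPerfectComplex_of_isIso I hI X hp ((hker X).1 hX))
  -- `Γ.obj X` is `I` placed in degree 0, a nonzero object of `functorKernel L`.
  let X := (singleFunctor (ModuleCat.{u} A) 0).obj (ModuleCat.of A A)
  have hX : functorKernel L (Γ.obj X) := (hker _).2 (hε' X)
  rw [← hS] at hX
  have h1 : IsZero ((singleFunctor (ModuleCat.{u} A) 0).obj (F.obj (ModuleCat.of A A))) :=
    IsZero.of_iso hX ((F.mapDerivedCategorySingleFunctor 0).app (ModuleCat.of A A)).symm
  have h2 : IsZero (F.obj (ModuleCat.of A A)) :=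
    IsZero.of_full_of_faithful_of_isZero (singleFunctor (ModuleCat.{u} A) 0) _ h1
  have h3 : IsZero (ModuleCat.of A I) := h2.of_iso (ρ_ (ModuleCat.of A I)).symm
  rw [ModuleCat.isZero_iff_subsingleton] at h3
  exact hI₀ (Submodule.subsingleton_iff_eq_bot.1 h3)

theorem ValuationRing.not_telescopeConjecture [IsDomain A] [ValuationRing A]
    [HasDerivedCategory.{w} (ModuleCat.{u} A)]
    (h : ¬ (IsLocalRing.maximalIdeal A).IsPrincipal) : ¬ TelescopeConjecture A := by
  have : Module.Flat A (IsLocalRing.maximalIdeal A) := by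
    -- Over a Bézout domain flat means torsion-free, which every ideal is.
    rw [Module.Flat.flat_iff_torsion_eq_bot_of_isBezout, ← Submodule.isTorsionFree_iff_torsion_eq_bot]
    infer_instance
  refine not_telescopeConjecture_of_ideal (IsLocalRing.maximalIdeal A) ?_ ?_
    fun a => ValuationRing.exists_mul_eq_of_mem_maximalIdeal h
  · rw [IsLocalRing.jacobson_eq_maximalIdeal ⊥ bot_ne_top]
  · intro h0
    exact h (h0 ▸ bot_isPrincipal)

end Telescope

end

theorem mainTheorem11 :
    (∃ (A : Type u) (_ : CommRing A) (_ : IsDomain A) (_ : ValuationRing A),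
      Countable A ∧ HasLexValueGroup A) ∧
    (∀ (A : Type u) [CommRing A] [IsDomain A] [ValuationRing A], HasLexValueGroup A →
      ¬ (IsLocalRing.maximalIdeal A).IsPrincipal ∧
      globalDimension A = 2 ∧
      ∀ [HasDerivedCategory.{w} (ModuleCat.{u} A)], ¬ TelescopeConjecture A) :=
  ⟨exists_countable_hasLexValueGroup, fun _ _ _ _ h => ⟨h.not_isPrincipal_maximalIdeal,
    h.globalDimension_eq_two,
    ValuationRing.not_telescopeConjecture h.not_isPrincipal_maximalIdeal⟩⟩
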